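/- Let $k$ be an algebraically closed field and let $\mathfrak{a}$ be a semi-hereditary dualizing $k$-variety, that is, a (small) additive $k$-linear category with finite-dimensional Hom-spaces in which idempotents split, such that * (semi-hereditary) the category $\operatorname{mod}\mathfrak{a}$ of finitely presented right $\mathfrak{a}$-modules (cokernels of maps $\mathfrak{a}(-,A)\to\mathfrak{a}(-,B)$ in the category of functors $\mathfrak{a}^{\mathrm{op}}\to\operatorname{Mod}k$) is abelian and hereditary ($\operatorname{Ext}^i=0$ for $i\ge 2$), and * (dualizing) the pointwise dual $D$, $(DM)(A)=\operatorname{Hom}_k(M(A),k)$, restricts to a duality $\operatorname{mod}\mathfrak{a}\to\operatorname{mod}\mathfrak{a}^{\mathrm{op}}$. For indecomposable objects $X,Y$ of $\mathfrak{a}$ let $[X,Y]$ be the full replete additive subcategory of $\mathfrak{a}$ whose objects are the finite direct sums of indecomposable objects $Z$ with $\mathfrak{a}(X,Z)\neq0$ and $\mathfrak{a}(Z,Y)\neq 0$. An indecomposable object $A$ is a thread object if it has a unique direct successor and a unique direct predecessor, i.e. there are nonzero maps $f:A\to M$ and $g:N\to A$ with $M,N$ indecomposable such that $f$ is not a split monomorphism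 and every map $A\to B$ that is not a split monomorphism factors through $f$, and $g$ is not a split epimorphism and every map $B\to A$ that is not a split epimorphism factors through $g$. The subcategory $[X,Y]$ is called a thread if it is nonzero and every indecomposable object in $[X,Y]$ is a thread object of $\mathfrak{a}$. Then for every thread $[X,Y]$ there is a linearly ordered set $\mathcal{L}$ that has a minimum and a maximum and is locally discrete (it has no accumulation points: every element other than the maximum has an immediate successor and every element other than the minimum has an immediate predecessor), together with a $k$-linear equivalence of categories $[X,Y]\simeq k\mathcal{L}$. Here $k\mathcal{L}$ is the $k$-linear additive category generated by the poset $\mathcal{L}$: the $k$-linearization of $\mathcal{L}$, seen as a category with exactly one morphism $a\to b$ if $a\le b$ and none otherwise, with finite direct sums formally added. -/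

import Mathlib

open CategoryTheory CategoryTheory.Limits Opposite

universe v u

noncomputable section

namespace ThreadVariety

section Modules

variable (k : Type v) [Field k] (C : Type u) [Category.{v} C] [Preadditive C] [Linear k C]

/-- A right module `M : Cᵒᵖ ⥤ ModuleCat k` is finitely presented if there is an exact sequence
`C(-, A) ⟶ C(-, B) ⟶ M ⟶ 0` with `A`, `B` objects of `C`. (Such a functor is automatically
`k`-linear; when `C` is additive with split idempotents, the standard projectives `C(-, A)` are,
up to isomorphism, all the finitely generated projective right modules.) -/
def rightFP : ObjectProperty (Cᵒᵖ ⥤ ModuleCat.{v} k) := fun M =>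
  ∃ (A B : C) (f : A ⟶ B) (p : (linearYoneda k C).obj B ⟶ M), ∀ X : Cᵒᵖ,
    Function.Exact (((linearYoneda k C).map f).app X) (p.app X) ∧ Function.Surjective (p.app X)

/-- A left module `N : C ⥤ ModuleCat k`, that is, a right module over the opposite category, is
finitely presented if there is an exact sequence `C(B, -) ⟶ C(A, -) ⟶ N ⟶ 0`. -/
def leftFP : ObjectProperty (C ⥤ ModuleCat.{v} k) := fun N =>
  ∃ (A B : C) (f : A ⟶ B) (p : (linearCoyoneda k C).obj (op A) ⟶ N), ∀ X : C,
    Function.Exact (((linearCoyoneda k C).map f.op).app X) (p.app X) ∧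
      Function.Surjective (p.app X)

/-- `mod C`, the category of finitely presented right `C`-modules. -/
abbrev RightMod := (rightFP k C).FullSubcategory

/-- `mod Cᵒᵖ`, the category of finitely presented left `C`-modules. -/
abbrev LeftMod := (leftFP k C).FullSubcategory

/-- `C` is semi-hereditary: `mod C` is abelian, and hereditary in the sense that `Extⁱ` vanishes
on it for all `i ≥ 2`. -/
def IsSemiHereditary : Prop :=
  ∃ _ : Abelian (RightMod k C), ∀ M : RightMod k C, HasProjectiveDimensionLE M 1

/-- The functor `V ↦ Hom_k(V, k)`. -/
def vectorDual : (ModuleCat.{v} k)ᵒᵖ ⥤ ModuleCat.{v} k where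
  obj V := ModuleCat.of k (Module.Dual k V.unop)
  map f := ModuleCat.ofHom (Module.Dual.transpose (R := k) f.unop.hom)

/-- The pointwise dual `D`, with `(D M)(X) = Hom_k(M(X), k)`. -/
def moduleDual : (Cᵒᵖ ⥤ ModuleCat.{v} k)ᵒᵖ ⥤ (C ⥤ ModuleCat.{v} k) :=
  (Functor.leftOpRightOpEquiv C (ModuleCat.{v} k)).functor ⋙
    (Functor.whiskeringRight C _ _).obj (vectorDual k)

/-- `C` is dualizing: the pointwise dual `D` restricts to a duality from `mod C` to `mod Cᵒᵖ`. -/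
def IsDualizing : Prop :=
  ∃ h : ∀ M : (RightMod k C)ᵒᵖ, leftFP k C (((rightFP k C).ι.op ⋙ moduleDual k C).obj M),
    ((leftFP k C).lift ((rightFP k C).ι.op ⋙ moduleDual k C) h).IsEquivalence

end Modules

section Threads

variable {C : Type u} [Category.{v} C] [Preadditive C]

/-- `f : A ⟶ M` is not a split monomorphism, and every map out of `A` that is not a split
monomorphism factors through `f`. -/
def IsAlmostSplitFrom {A M : C} (f : A ⟶ M) : Prop :=
  ¬ IsSplitMono f ∧ ∀ ⦃B : C⦄ (g : A ⟶ B), ¬ IsSplitMono g → ∃ h : M ⟶ B, f ≫ h = g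

/-- `f : N ⟶ A` is not a split epimorphism, and every map into `A` that is not a split
epimorphism factors through `f`. -/
def IsAlmostSplitTo {N A : C} (f : N ⟶ A) : Prop :=
  ¬ IsSplitEpi f ∧ ∀ ⦃B : C⦄ (g : B ⟶ A), ¬ IsSplitEpi g → ∃ h : B ⟶ N, h ≫ f = g

attribute [local instance] hasBinaryBiproducts_of_finite_biproducts

variable [HasFiniteBiproducts C]

/-- An indecomposable object with a unique direct successor and a unique direct predecessor:
there are nonzero almost split maps `A ⟶ M` and `N ⟶ A` with `M` and `N` indecomposable.
(Without `f ≠ 0`, an object without any direct successor, i.e. out of which every map that is not a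
split monomorphism is zero, would pass the first test through a zero map; dually for the second.) -/
def IsThreadObject (A : C) : Prop :=
  Indecomposable A ∧
    (∃ (M : C) (f : A ⟶ M), Indecomposable M ∧ f ≠ 0 ∧ IsAlmostSplitFrom f) ∧
    (∃ (N : C) (f : N ⟶ A), Indecomposable N ∧ f ≠ 0 ∧ IsAlmostSplitTo f)

/-- The full replete additive subcategory `[X, Y]`: its objects are those isomorphic to a finite
direct sum of indecomposable objects `Z` with `C(X, Z) ≠ 0` and `C(Z, Y) ≠ 0`. -/
def interval (X Y : C) : ObjectProperty C := fun W =>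
  ∃ (n : ℕ) (Z : Fin n → C),
    (∀ i, Indecomposable (Z i) ∧ (∃ f : X ⟶ Z i, f ≠ 0) ∧ ∃ g : Z i ⟶ Y, g ≠ 0) ∧
      Nonempty (W ≅ ⨁ Z)

/-- `[X, Y]` is a thread: `X` and `Y` are indecomposable, `[X, Y]` is not zero, and every
indecomposable object in `[X, Y]` is a thread object of `C`. -/
structure IsThread (X Y : C) : Prop where
  indecomposable_left : Indecomposable X
  indecomposable_right : Indecomposable Y
  nonzero : ∃ Z : C, Indecomposable Z ∧ interval X Y Z
  isThreadObject : ∀ Z : C, Indecomposable Z → interval X Y Z → IsThreadObject Z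

end Threads

section Posets

/-- A linearly ordered set is locally discrete (has no accumulation points) if every element that
is not maximal has an immediate successor and every element that is not minimal has an immediate
predecessor. -/
def IsLocallyDiscrete (L : Type u) [LinearOrder L] : Prop :=
  (∀ a : L, ¬ IsMax a → ∃ b, a ⋖ b) ∧ (∀ a : L, ¬ IsMin a → ∃ b, b ⋖ a)

variable (k : Type v) [Field k]

/-- The entrywise `k`-linear structure on the additive completion of a `k`-linear category. -/
instance matLinear (D : Type*) [Category* D] [Preadditive D] [Linear k D] :
    Linear k (Mat_ D) where
  homModule M N := inferInstanceAs (Module k (∀ (i : M.ι) (j : N.ι), M.X i ⟶ N.X j))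
  smul_comp M N K r f g := by
    ext i j
    change ∑ l, (r • f i l) ≫ g l j = r • ∑ l, f i l ≫ g l j
    simp [Finset.smul_sum]
  comp_smul M N K f r g := by
    ext i j
    change ∑ l, f i l ≫ (r • g l j) = r • ∑ l, f i l ≫ g l j
    simp [Finset.smul_sum]

/-- The `k`-linear additive category `kL` of a poset `L`: the `k`-linearization of `L` (seen as a
category with one morphism `a ⟶ b` for `a ≤ b`), with finite biproducts formally added. -/
abbrev PosetLinearization (L : Type u) [Preorder L] := Mat_ (Free k L)

end Posets

end ThreadVariety

end

noncomputable section

namespace ThreadVariety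

section Hereditary

variable {A : Type*} [Category* A] [Abelian A]

lemma projective_kernel_of_hasProjectiveDimensionLE_one
    (h : ∀ M : A, HasProjectiveDimensionLE M 1) {P M : A} [Projective P] (g : P ⟶ M) :
    Projective (kernel g) := by
  let S : ShortComplex A := ShortComplex.mk (kernel.ι g) (Abelian.factorThruImage g) (by
    rw [← cancel_mono (Abelian.image.ι g), Category.assoc, Abelian.image.fac, kernel.condition,
      zero_comp])
  have hS : S.ShortExact :=
    { exact := by
        apply ShortComplex.exact_of_f_is_kernel
        refine KernelFork.IsLimit.ofι _ _ (fun t ht => kernel.lift g t ?_) ?_ ?_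
        · rw [← Abelian.image.fac g, reassoc_of% ht, zero_comp]
        · intro _ t ht
          exact kernel.lift_ι _ _ _
        · intro _ t ht m hm
          rw [← cancel_mono (kernel.ι g), hm]; simp
      mono_f := inferInstanceAs (Mono (kernel.ι g))
      epi_g := inferInstanceAs (Epi (Abelian.factorThruImage g)) }
  have h3 := h S.X₃
  have h2 : HasProjectiveDimensionLT S.X₂ 1 := inferInstanceAs (HasProjectiveDimensionLT P 1)
  have := hS.hasProjectiveDimensionLT_X₁ 1 h2 h3
  exact projective_iff_hasProjectiveDimensionLT_one.2 this

lemma exists_projective_kernel (h : ∀ M : A, HasProjectiveDimensionLE M 1)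
    (z : ∀ P Q : A, P ⟶ Q) (hz : ∀ (P Q : A) (f : P ⟶ P), f ≫ z P Q = z P Q)
    {P M : A} [Projective P] (g : P ⟶ M) :
    ∃ (K : A) (ι : K ⟶ P), Projective K ∧ Mono ι ∧ ι ≫ g = z K M ∧
      ∀ ⦃T : A⦄ (t : T ⟶ P), t ≫ g = z T M → ∃ t' : T ⟶ K, t' ≫ ι = t := by
  have hz0 : ∀ P Q : A, z P Q = 0 := fun P Q => by rw [← hz P Q 0, zero_comp]
  simp only [hz0]
  exact ⟨kernel g, kernel.ι g, projective_kernel_of_hasProjectiveDimensionLE_one h g,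
    inferInstance, kernel.condition g, fun T t ht => ⟨kernel.lift g t ht, kernel.lift_ι _ _ _⟩⟩

end Hereditary

section FinitelyPresented

variable {k : Type v} [Field k] {C : Type u} [Category.{v} C] [Preadditive C] [Linear k C]

/-- The components of a map out of a standard projective. -/
def component {M : Cᵒᵖ ⥤ ModuleCat.{v} k} {Y : C} (θ : (linearYoneda k C).obj Y ⟶ M) (V : C) :
    (V ⟶ Y) →ₗ[k] M.obj (op V) :=
  (θ.app (op V)).hom

lemma component_comp {M : Cᵒᵖ ⥤ ModuleCat.{v} k} {Y : C} (θ : (linearYoneda k C).obj Y ⟶ M)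
    {V W : C} (f : V ⟶ W) (h : W ⟶ Y) :
    component θ V (f ≫ h) = M.map f.op (component θ W h) :=
  congr($(θ.naturality f.op) h)

lemma component_eq {M : Cᵒᵖ ⥤ ModuleCat.{v} k} {Y : C} (θ : (linearYoneda k C).obj Y ⟶ M)
    {V : C} (f : V ⟶ Y) : component θ V f = M.map f.op (component θ Y (𝟙 Y)) := by
  rw [← component_comp, Category.comp_id]

lemma component_map_comp {M : Cᵒᵖ ⥤ ModuleCat.{v} k} {Y Z : C} (b : Z ⟶ Y)
    (θ : (linearYoneda k C).obj Y ⟶ M) {V : C} (h : V ⟶ Z) :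
    component ((linearYoneda k C).map b ≫ θ) V h = component θ V (h ≫ b) := rfl

lemma component_comp_app {M N : Cᵒᵖ ⥤ ModuleCat.{v} k} {Y : C} (η : M ⟶ N)
    (θ : (linearYoneda k C).obj Y ⟶ M) {V : C} (h : V ⟶ Y) :
    component (θ ≫ η) V h = η.app (op V) (component θ V h) := rfl

lemma component_injective {M : Cᵒᵖ ⥤ ModuleCat.{v} k} {Y : C}
    {θ θ' : (linearYoneda k C).obj Y ⟶ M}
    (h : component θ Y (𝟙 Y) = component θ' Y (𝟙 Y)) : θ = θ' := by
  have key : ∀ (V : C) (g : V ⟶ Y), component θ V g = component θ' V g := fun V g => by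
    rw [component_eq, h, ← component_eq]
  exact NatTrans.ext (funext fun V => ModuleCat.hom_ext (LinearMap.ext fun g => key V.unop g))

lemma rightFP_iff {M : Cᵒᵖ ⥤ ModuleCat.{v} k} : rightFP k C M ↔
    ∃ (A B : C) (f : A ⟶ B) (p : (linearYoneda k C).obj B ⟶ M),
      (∀ (V : C) (x : V ⟶ B), component p V x = 0 ↔ ∃ y : V ⟶ A, y ≫ f = x) ∧
        ∀ V : C, Function.Surjective (component p V) :=
  ⟨fun ⟨A, B, f, p, hp⟩ => ⟨A, B, f, p, fun V => (hp (op V)).1, fun V => (hp (op V)).2⟩,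
    fun ⟨A, B, f, p, hp, hp'⟩ => ⟨A, B, f, p, fun V => ⟨hp V.unop, hp' V.unop⟩⟩⟩

lemma exists_component_eq {M : Cᵒᵖ ⥤ ModuleCat.{v} k} (hM : rightFP k C M) {Y : C}
    (t : M.obj (op Y)) :
    ∃ θ : (linearYoneda k C).obj Y ⟶ M, component θ Y (𝟙 Y) = t := by
  obtain ⟨A, B, f, p, -, hp⟩ := rightFP_iff.1 hM
  obtain ⟨b, rfl⟩ := hp Y t
  exact ⟨(linearYoneda k C).map b ≫ p, by rw [component_map_comp, Category.id_comp]⟩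

lemma rightFP_linearYoneda (Y : C) : rightFP k C ((linearYoneda k C).obj Y) := by
  refine rightFP_iff.2 ⟨Y, Y, 0, 𝟙 _, fun V x => ?_, fun V x => ⟨x, rfl⟩⟩
  change x = 0 ↔ _
  constructor
  · rintro rfl
    exact ⟨0, zero_comp⟩
  · rintro ⟨y, rfl⟩
    exact comp_zero

/-- The standard projective as an object of `mod C`. -/
def standardProjective (k : Type v) [Field k] [Linear k C] (Y : C) : RightMod k C :=
  ⟨(linearYoneda k C).obj Y, rightFP_linearYoneda Y⟩

lemma epi_of_surjective_component {N : RightMod k C} {Y : C} (p : standardProjective k Y ⟶ N)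
    (hp : ∀ V : C, Function.Surjective (component p.hom V)) : Epi p where
  left_cancellation {Z} g h hgh := by
    ext : 1
    refine NatTrans.ext (funext fun V => ModuleCat.hom_ext (LinearMap.ext fun n => ?_))
    obtain ⟨x, rfl⟩ := hp V.unop n
    exact congr(($(hgh)).hom.app V x)

/-- A morphism of `C` as a morphism between standard projectives. -/
def standardMap (k : Type v) [Field k] [Linear k C] {Y Z : C} (f : Y ⟶ Z) :
    standardProjective k Y ⟶ standardProjective k Z :=
  ObjectProperty.homMk ((linearYoneda k C).map f)

lemma standardMap_comp {X Y Z : C} (f : X ⟶ Y) (g : Y ⟶ Z) :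
    standardMap k (f ≫ g) = standardMap k f ≫ standardMap k g := by
  ext : 1
  exact (linearYoneda k C).map_comp f g

lemma standardMap_id (X : C) : standardMap k (𝟙 X) = 𝟙 (standardProjective k X) := by
  ext : 1
  exact (linearYoneda k C).map_id X

lemma standardMap_surjective {Y Z : C} (φ : standardProjective k Y ⟶ standardProjective k Z) :
    ∃ f : Y ⟶ Z, standardMap k f = φ :=
  ⟨(linearYoneda k C).preimage φ.hom, by ext : 1; exact (linearYoneda k C).map_preimage φ.hom⟩

lemma standardMap_injective {Y Z : C} {f g : Y ⟶ Z} (h : standardMap k f = standardMap k g) :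
    f = g :=
  (linearYoneda k C).map_injective congr($(h).hom)

/-- A projective object of `mod C` is represented by an object of `C`. -/
lemma exists_iso_standardProjective [IsIdempotentComplete C] (N : RightMod k C) [Projective N] :
    ∃ U : C, Nonempty (standardProjective k U ≅ N) := by
  obtain ⟨A, B, f, p, -, hp⟩ := rightFP_iff.1 N.property
  let p' : standardProjective k B ⟶ N := ObjectProperty.homMk p
  have : Epi p' := epi_of_surjective_component p' hp
  let s : N ⟶ standardProjective k B := Projective.factorThru (𝟙 N) p'
  have hs : s ≫ p' = 𝟙 N := Projective.factorThru_comp _ _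
  obtain ⟨e, he⟩ := standardMap_surjective (p' ≫ s)
  have hee : e ≫ e = e := by
    apply standardMap_injective (k := k)
    rw [standardMap_comp, he, Category.assoc, reassoc_of% hs]
  obtain ⟨U, i, r, hir, hri⟩ := IsIdempotentComplete.idempotents_split B e hee
  refine ⟨U, ⟨⟨standardMap k i ≫ p', s ≫ standardMap k r, ?_, ?_⟩⟩⟩
  · rw [Category.assoc, ← reassoc_of% he, ← standardMap_id, ← standardMap_comp,
      ← standardMap_comp, ← hri, Category.assoc, hir, Category.comp_id, hir]
  · rw [Category.assoc, ← Category.assoc (standardMap k r), ← standardMap_comp, hri, he,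
      Category.assoc, reassoc_of% hs, hs]

variable [HasFiniteBiproducts C]

attribute [local instance] hasBinaryBiproducts_of_finite_biproducts

lemma surjective_app_of_epi {M N : RightMod k C} (e : M ⟶ N) [Epi e] (V : C) :
    Function.Surjective (e.hom.app (op V)) := by
  obtain ⟨A, B, f, p, hp, hps⟩ := rightFP_iff.1 N.property
  obtain ⟨A', B', f', p', hp', hps'⟩ := rightFP_iff.1 M.property
  let q : N.obj ⟶ cokernel e.hom := cokernel.π e.hom
  have hq : ∀ W : C, Function.Surjective (q.app (op W)) := fun W =>
    (ModuleCat.epi_iff_surjective _).1 inferInstance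
  have hex : ∀ W : C, Function.Exact (e.hom.app (op W)) (q.app (op W)) := fun W => by
    have h1 : (ShortComplex.mk e.hom q (cokernel.condition _)).Exact :=
      ShortComplex.exact_cokernel _
    have h2 := h1.map ((evaluation Cᵒᵖ (ModuleCat.{v} k)).obj (op W))
    exact (ShortComplex.ShortExact.moduleCat_exact_iff_function_exact _).1 h2
  obtain ⟨b, hb⟩ := hps B' (e.hom.app _ (component p' B' (𝟙 B')))
  have hcomm : (linearYoneda k C).map b ≫ p = p' ≫ e.hom := by
    apply component_injective
    rw [component_map_comp, component_comp_app, Category.id_comp, hb]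
  have hcomm' : ∀ (W : C) (x : W ⟶ B'), component p W (x ≫ b) =
      e.hom.app (op W) (component p' W x) := fun W x => by
    rw [← component_map_comp, hcomm, component_comp_app]
  have hQ : rightFP k C (cokernel e.hom) := by
    refine rightFP_iff.2 ⟨A ⊞ B', B, biprod.desc f b, p ≫ q, fun W x => ⟨fun hx => ?_, ?_⟩,
      fun W => (hq W).comp (hps W)⟩
    · obtain ⟨m, hm⟩ := (hex W _).1 (show q.app (op W) (component p W x) = 0 from hx)
      obtain ⟨b', rfl⟩ := hps' W m
      rw [← hcomm'] at hm
      obtain ⟨a, ha⟩ := (hp W (x - b' ≫ b)).1 (by rw [map_sub, hm, sub_self])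
      exact ⟨biprod.lift a b', by rw [biprod.lift_desc, ha]; exact sub_add_cancel _ _⟩
    · rintro ⟨y, rfl⟩
      change q.app (op W) (component p W (y ≫ biprod.desc f b)) = 0
      rw [biprod.desc_eq, Preadditive.comp_add, map_add,
        (hp W _).2 ⟨y ≫ biprod.fst, Category.assoc _ _ _⟩, zero_add, ← Category.assoc, hcomm']
      exact (hex W _).2 ⟨_, rfl⟩
  let Q : RightMod k C := ⟨cokernel e.hom, hQ⟩
  have hz : (ObjectProperty.homMk q : N ⟶ Q) = ObjectProperty.homMk 0 := by
    rw [← cancel_epi e]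
    ext : 1
    change e.hom ≫ q = e.hom ≫ 0
    rw [comp_zero]; exact cokernel.condition _
  have hz' : q = 0 := congr($(hz).hom)
  intro n
  refine (hex V n).1 ?_
  rw [hz']; rfl

instance projective_standardProjective (Y : C) : Projective (standardProjective k Y) where
  factors {N M} f e _ := by
    obtain ⟨m, hm⟩ := surjective_app_of_epi e Y (component f.hom Y (𝟙 Y))
    obtain ⟨θ, hθ⟩ := exists_component_eq N.property m
    refine ⟨ObjectProperty.homMk θ, ?_⟩
    ext : 1
    apply component_injective (θ := θ ≫ e.hom) (θ' := f.hom)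
    rw [component_comp_app, hθ, hm]

/-- In the semi-hereditary case, the kernel of a map from a standard projective to a finitely
presented module is represented by a monomorphism of `C`. -/
lemma IsSemiHereditary.exists_kernel [IsIdempotentComplete C] (hsh : IsSemiHereditary k C)
    {Y : C} {M : RightMod k C} (t : M.obj.obj (op Y)) :
    ∃ (U : C) (u : U ⟶ Y), Mono u ∧ M.obj.map u.op t = 0 ∧
      ∀ ⦃V : C⦄ (h : V ⟶ Y), M.obj.map h.op t = 0 → ∃ h' : V ⟶ U, h' ≫ u = h := by
  obtain ⟨θ₀, rfl⟩ := exists_component_eq M.property t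
  let θ : standardProjective k Y ⟶ M := ObjectProperty.homMk θ₀
  have hker : ∃ (K : RightMod k C) (ι : K ⟶ standardProjective k Y), Projective K ∧ Mono ι ∧
      ι ≫ θ = ObjectProperty.homMk 0 ∧ ∀ ⦃T : RightMod k C⦄ (t : T ⟶ standardProjective k Y),
        t ≫ θ = ObjectProperty.homMk 0 → ∃ t' : T ⟶ K, t' ≫ ι = t := by
    obtain ⟨_, hdim⟩ := hsh
    refine exists_projective_kernel hdim (fun P Q => ObjectProperty.homMk 0) (fun P Q f => ?_) θ
    ext : 1
    exact comp_zero
  obtain ⟨K, ι, _, _, hι, hK⟩ := hker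
  have hzc : ∀ (V : C) (h : V ⟶ Y), M.obj.map h.op (component θ₀ Y (𝟙 Y)) = 0 ↔
      standardMap k h ≫ θ = ObjectProperty.homMk 0 := fun V h => by
    have e0 : component ((linearYoneda k C).map h ≫ θ₀) V (𝟙 V) = component θ₀ V h := by
      rw [component_map_comp, Category.id_comp]
    rw [← component_eq, ← e0]
    constructor
    · intro e
      ext : 1
      exact component_injective (θ := (linearYoneda k C).map h ≫ θ₀) (θ' := 0) (e.trans rfl)
    · intro e
      exact congr(component ($(e).hom) V (𝟙 V))
  obtain ⟨U, ⟨i⟩⟩ := exists_iso_standardProjective K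
  obtain ⟨u, hu⟩ := standardMap_surjective (i.hom ≫ ι)
  refine ⟨U, u, ⟨fun {Z} g h hgh => ?_⟩, ?_, fun V h hh => ?_⟩
  · apply standardMap_injective (k := k)
    rw [← cancel_mono (i.hom ≫ ι), ← hu, ← standardMap_comp, hgh, standardMap_comp]
  · rw [hzc, hu, Category.assoc, hι]
    ext : 1
    exact comp_zero
  · rw [hzc] at hh
    obtain ⟨t, ht⟩ := hK _ hh
    obtain ⟨h', hh'⟩ := standardMap_surjective (t ≫ i.inv)
    refine ⟨h', standardMap_injective (k := k) ?_⟩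
    rw [standardMap_comp, hh', hu, Category.assoc, Iso.inv_hom_id_assoc, ht]

/-- Kernels exist in a semi-hereditary category. -/
lemma IsSemiHereditary.exists_mono_kernel [IsIdempotentComplete C] (hsh : IsSemiHereditary k C)
    {A B : C} (f : A ⟶ B) : ∃ (K : C) (u : K ⟶ A), Mono u ∧ u ≫ f = 0 ∧
      ∀ ⦃V : C⦄ (h : V ⟶ A), h ≫ f = 0 → ∃ h' : V ⟶ K, h' ≫ u = h :=
  hsh.exists_kernel (M := standardProjective k B) (Y := A) f

/-- Every morphism factors as a split epimorphism followed by a monomorphism. -/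
lemma IsSemiHereditary.exists_splitEpi_mono [IsIdempotentComplete C]
    (hsh : IsSemiHereditary k C) {A B : C} (f : A ⟶ B) :
    ∃ (U : C) (r : A ⟶ U) (s : U ⟶ A) (u : U ⟶ B), s ≫ r = 𝟙 U ∧ Mono u ∧ r ≫ u = f := by
  let F := (linearYoneda k C).map f
  have hex : ∀ W : C, Function.Exact (F.app (op W)) ((cokernel.π F).app (op W)) := fun W => by
    have h1 : (ShortComplex.mk F _ (cokernel.condition _)).Exact :=
      ShortComplex.exact_cokernel _
    have h2 := h1.map ((evaluation Cᵒᵖ (ModuleCat.{v} k)).obj (op W))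
    exact (ShortComplex.ShortExact.moduleCat_exact_iff_function_exact _).1 h2
  have hQ : rightFP k C (cokernel F) := rightFP_iff.2 ⟨A, B, f, cokernel.π F,
    fun W x => hex W x, fun W => (ModuleCat.epi_iff_surjective _).1 inferInstance⟩
  obtain ⟨U, u, hu, hu0, hU⟩ := hsh.exists_kernel (M := ⟨cokernel F, hQ⟩)
    (component (cokernel.π F) B (𝟙 B))
  simp only [← component_eq] at hu0 hU
  obtain ⟨r, hr⟩ := hU f ((hex A f).2 ⟨𝟙 A, Category.id_comp f⟩)
  obtain ⟨s, hs⟩ : ∃ s : U ⟶ A, s ≫ f = u := (hex U u).1 hu0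
  refine ⟨U, r, s, u, ?_, hu, hr⟩
  rw [← cancel_mono u, Category.assoc, hr, hs, Category.id_comp]

/-- For a linear form `l` on `C(X, Y)`, the subfunctor of `C(-, Y)` of all `h` with `l (x ≫ h) = 0`
for all `x` is represented by a monomorphism. -/
lemma IsDualizing.exists_kernel [IsIdempotentComplete C] (hdual : IsDualizing k C)
    (hfin : ∀ A B : C, FiniteDimensional k (A ⟶ B)) (hsh : IsSemiHereditary k C)
    {X Y : C} (l : (X ⟶ Y) →ₗ[k] k) :
    ∃ (U : C) (u : U ⟶ Y), Mono u ∧ (∀ x : X ⟶ U, l (x ≫ u) = 0) ∧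
      ∀ ⦃V : C⦄ (h : V ⟶ Y), (∀ x : X ⟶ V, l (x ≫ h) = 0) → ∃ h' : V ⟶ U, h' ≫ u = h := by
  obtain ⟨h, heq⟩ := hdual
  have hfp : leftFP k C ((linearCoyoneda k C).obj (op X)) := by
    refine ⟨X, X, 0, 𝟙 _, fun V => ⟨fun x => ?_, fun x => ⟨x, rfl⟩⟩⟩
    constructor
    · intro hx
      exact ⟨(0 : X ⟶ V), (zero_comp : (0 : X ⟶ X) ≫ (0 : X ⟶ V) = 0).trans hx.symm⟩
    · rintro ⟨y, rfl⟩
      exact (zero_comp : (0 : X ⟶ X) ≫ (show X ⟶ V from y) = 0)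
  obtain ⟨⟨M⟩, ⟨α⟩⟩ := heq.essSurj.mem_essImage ⟨_, hfp⟩
  have hMfin : ∀ V : C, FiniteDimensional k (M.obj.obj (op V)) := fun V => by
    obtain ⟨A, B, f, p, -, hp⟩ := rightFP_iff.1 M.property
    have := hfin V B
    exact Module.Finite.of_surjective (component p V) (hp V)
  let β : (moduleDual k C).obj (op M.obj) ≅ (linearCoyoneda k C).obj (op X) :=
    (leftFP k C).ι.mapIso α
  let b (V : C) : Module.Dual k (M.obj.obj (op V)) →ₗ[k] (X ⟶ V) := (β.hom.app V).hom
  have hb : ∀ V, Function.Surjective (b V) := fun V =>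
    (ModuleCat.epi_iff_surjective (β.hom.app V)).1 inferInstance
  have hbn : ∀ {V W : C} (g : V ⟶ W) (φ : Module.Dual k (M.obj.obj (op V))),
      b W (φ ∘ₗ (M.obj.map g.op).hom) = b V φ ≫ g := fun g φ => congr($(β.hom.naturality g) φ)
  let t : M.obj.obj (op Y) := (Module.evalEquiv k (M.obj.obj (op Y))).symm (l ∘ₗ b Y)
  have ht : ∀ φ : Module.Dual k (M.obj.obj (op Y)), φ t = l (b Y φ) := fun φ => by
    rw [← Module.Dual.eval_apply k, ← Module.evalEquiv_toLinearMap]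
    exact congr($((Module.evalEquiv k (M.obj.obj (op Y))).apply_symm_apply (l ∘ₗ b Y)) φ)
  have hiff : ∀ (V : C) (g : V ⟶ Y), M.obj.map g.op t = 0 ↔ ∀ x : X ⟶ V, l (x ≫ g) = 0 := by
    intro V g
    rw [← Module.forall_dual_apply_eq_zero_iff k, (hb V).forall]
    refine forall_congr' fun φ => ?_
    rw [← hbn, ← ht]
    rfl
  obtain ⟨U, u, hu, hu0, hU⟩ := hsh.exists_kernel t
  exact ⟨U, u, hu, (hiff U u).1 hu0, fun V h hh => hU h ((hiff V h).2 hh)⟩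

end FinitelyPresented

section Indecomposables

variable {k : Type v} [Field k] {C : Type u} [Category.{v} C] [Preadditive C] [Linear k C]

lemma not_isZero_of_hom_ne_zero {A B : C} {f : A ⟶ B} (hf : f ≠ 0) : ¬ IsZero B :=
  fun h => hf (h.eq_of_tgt _ _)

variable [HasFiniteBiproducts C]

attribute [local instance] hasBinaryBiproducts_of_finite_biproducts

lemma finrank_end_biprod (hfin : ∀ A B : C, FiniteDimensional k (A ⟶ B)) {W U V : C}
    (e : W ≅ U ⊞ V) (hV : ¬ IsZero V) :
    Module.finrank k (U ⟶ U) < Module.finrank k (W ⟶ W) := by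
  have := hfin
  let φ : ((U ⟶ U) × (V ⟶ V)) →ₗ[k] (W ⟶ W) :=
    { toFun := fun p => e.hom ≫ biprod.map p.1 p.2 ≫ e.inv
      map_add' := fun p q => by
        rw [← Preadditive.comp_add, ← Preadditive.add_comp]
        congr 2
        ext <;> simp
      map_smul' := fun c p => by
        simp only [Prod.smul_fst, Prod.smul_snd, RingHom.id_apply]
        rw [← Linear.comp_smul, ← Linear.smul_comp]
        congr 2
        ext <;> simp }
  have hφ : Function.Injective φ := fun p q hpq => by
    have : biprod.map p.1 p.2 = biprod.map q.1 q.2 := by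
      rw [← cancel_epi e.hom, ← cancel_mono e.inv, Category.assoc, Category.assoc]
      exact hpq
    refine Prod.ext ?_ ?_
    · simpa using congr(biprod.inl ≫ $this ≫ biprod.fst)
    · simpa using congr(biprod.inr ≫ $this ≫ biprod.snd)
  have h1 := LinearMap.finrank_le_finrank_of_injective hφ
  rw [Module.finrank_prod] at h1
  have h2 : 0 < Module.finrank k (V ⟶ V) := by
    have : Nontrivial (V ⟶ V) := ⟨𝟙 V, 0, fun h => hV ((IsZero.iff_id_eq_zero V).2 h)⟩
    exact Module.finrank_pos
  omega

/-- The three properties of a semi-hereditary dualizing variety on which the description of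
threads rests. -/
structure ThreadAmbient (k : Type v) [Field k] (C : Type u) [Category.{v} C] [Preadditive C]
    [Linear k C] [HasFiniteBiproducts C] : Prop where
  finiteDimensional : ∀ A B : C, FiniteDimensional k (A ⟶ B)
  mono_of_ne_zero : ∀ {A B : C} (f : A ⟶ B), Indecomposable A → f ≠ 0 → Mono f
  exists_kernel : ∀ {A B : C} (f : A ⟶ B), ∃ (K : C) (u : K ⟶ A), Mono u ∧ u ≫ f = 0 ∧
    ∀ ⦃V : C⦄ (h : V ⟶ A), h ≫ f = 0 → ∃ h' : V ⟶ K, h' ≫ u = h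
  exists_functional_kernel : ∀ {X Y : C} (l : (X ⟶ Y) →ₗ[k] k),
    ∃ (U : C) (u : U ⟶ Y), Mono u ∧ (∀ x : X ⟶ U, l (x ≫ u) = 0) ∧
      ∀ ⦃V : C⦄ (h : V ⟶ Y), (∀ x : X ⟶ V, l (x ≫ h) = 0) → ∃ h' : V ⟶ U, h' ≫ u = h

namespace ThreadAmbient

variable (H : ThreadAmbient k C)

include H in
lemma comp_ne_zero {A B D : C} (hB : Indecomposable B) {f : A ⟶ B} {g : B ⟶ D} (hf : f ≠ 0)
    (hg : g ≠ 0) : f ≫ g ≠ 0 := fun h => by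
  have := H.mono_of_ne_zero g hB hg
  exact hf ((cancel_mono g).1 (h.trans zero_comp.symm))

end ThreadAmbient
/-- A nonzero map has a nonzero component at some indecomposable summand of its target. -/
lemma exists_indecomposable_summand (hfin : ∀ A B : C, FiniteDimensional k (A ⟶ B)) {X U : C}
    (x : X ⟶ U) (hx : x ≠ 0) :
    ∃ (V : C) (i : V ⟶ U) (r : U ⟶ V), Indecomposable V ∧ i ≫ r = 𝟙 V ∧ x ≫ r ≠ 0 := by
  induction hn : Module.finrank k (U ⟶ U) using Nat.strong_induction_on generalizing U with
  | _ n ih =>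
    by_cases hU : Indecomposable U
    · exact ⟨U, 𝟙 U, 𝟙 U, hU, Category.comp_id _, by rwa [Category.comp_id]⟩
    · have hUz : ¬ IsZero U := not_isZero_of_hom_ne_zero hx
      obtain ⟨P, Q, e, hP, hQ⟩ : ∃ (P Q : C) (_ : U ≅ P ⊞ Q), ¬ IsZero P ∧ ¬ IsZero Q := by
        simpa [Indecomposable, hUz] using hU
      have step : ∀ (P Q : C) (i : P ⟶ U) (r : U ⟶ P), i ≫ r = 𝟙 P → (U ≅ P ⊞ Q) → ¬ IsZero Q →
          x ≫ r ≠ 0 → ∃ (V : C) (i : V ⟶ U) (r : U ⟶ V),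
            Indecomposable V ∧ i ≫ r = 𝟙 V ∧ x ≫ r ≠ 0 := by
        intro P Q i r hir e hQ hxr
        obtain ⟨V, i', r', hV, hir', hx'⟩ := ih _ (hn ▸ finrank_end_biprod hfin e hQ) _ hxr rfl
        exact ⟨V, i' ≫ i, r ≫ r', hV, by rw [Category.assoc, reassoc_of% hir, hir'],
          by rwa [← Category.assoc]⟩
      by_cases h1 : x ≫ e.hom ≫ biprod.fst = 0
      · refine step Q P (biprod.inr ≫ e.inv) (e.hom ≫ biprod.snd) (by simp)
          (e ≪≫ biprod.braiding P Q) hP fun h2 => hx ?_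
        rw [← cancel_mono e.hom]
        ext <;> simpa
      · exact step P Q (biprod.inl ≫ e.inv) (e.hom ≫ biprod.fst) (by simp) e hQ h1

variable [IsIdempotentComplete C]

/-- The complement of a split summand. -/
lemma exists_iso_biprod_of_retract {A U : C} (s : U ⟶ A) (r : A ⟶ U) (h : s ≫ r = 𝟙 U) :
    ∃ (V : C) (t : V ⟶ A) (q : A ⟶ V), t ≫ q = 𝟙 V ∧ r ≫ s + q ≫ t = 𝟙 A ∧
      Nonempty (A ≅ U ⊞ V) := by
  obtain ⟨V, t, q, htq, hqt⟩ := IsIdempotentComplete.idempotents_split A (𝟙 A - r ≫ s) (by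
    simp [reassoc_of% h])
  have hst : s ≫ q = 0 := by
    have : s ≫ q ≫ t = 0 := by rw [hqt]; simp [reassoc_of% h]
    rw [← Category.comp_id q, ← htq, reassoc_of% this, zero_comp]
  have htr : t ≫ r = 0 := by
    have : q ≫ t ≫ r = 0 := by rw [reassoc_of% hqt]; simp [h]
    rw [← Category.id_comp (t ≫ r), ← htq, Category.assoc, this, comp_zero]
  refine ⟨V, t, q, htq, by rw [hqt]; abel, ⟨⟨biprod.lift r q, biprod.desc s t, ?_, ?_⟩⟩⟩
  · rw [biprod.lift_desc, hqt]; abel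
  · ext <;> simp [h, hst, htr, htq]

/-- A nonzero retract of an indecomposable object is the whole object. -/
lemma retract_comp_eq_id {A U : C} (hA : Indecomposable A) (hU : ¬ IsZero U)
    {s : U ⟶ A} {r : A ⟶ U} (h : s ≫ r = 𝟙 U) : r ≫ s = 𝟙 A := by
  obtain ⟨V, t, q, -, hsum, ⟨e⟩⟩ := exists_iso_biprod_of_retract s r h
  have hV := (hA.2 _ _ e).resolve_left hU
  rwa [hV.eq_of_tgt q 0, zero_comp, add_zero] at hsum

lemma ThreadAmbient.of_isSemiHereditary_of_isDualizing
    (hfin : ∀ A B : C, FiniteDimensional k (A ⟶ B)) (hsh : IsSemiHereditary k C)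
    (hdual : IsDualizing k C) : ThreadAmbient k C where
  finiteDimensional := hfin
  mono_of_ne_zero {A B} f hA hf := by
    obtain ⟨U, r, s, u, hsr, hu, rfl⟩ := hsh.exists_splitEpi_mono f
    have hr : r ≠ 0 := fun h => hf (by rw [h, zero_comp])
    have : IsSplitMono r := ⟨⟨s, retract_comp_eq_id hA (not_isZero_of_hom_ne_zero hr) hsr⟩⟩
    exact mono_comp r u
  exists_kernel := hsh.exists_mono_kernel
  exists_functional_kernel := hdual.exists_kernel hfin hsh

end Indecomposables

section Segments

variable {k : Type v} [Field k] [IsAlgClosed k] {C : Type u} [Category.{v} C] [Preadditive C]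
  [Linear k C] [HasFiniteBiproducts C]

attribute [local instance] hasBinaryBiproducts_of_finite_biproducts

namespace ThreadAmbient

variable (H : ThreadAmbient k C)

include H

lemma end_eq_smul_id {A : C} (hA : Indecomposable A) (f : A ⟶ A) : ∃ c : k, f = c • 𝟙 A := by
  have := H.finiteDimensional
  have : Nontrivial (A ⟶ A) := ⟨𝟙 A, 0, fun h => hA.1 ((IsZero.iff_id_eq_zero A).2 h)⟩
  obtain ⟨c, hc⟩ := Module.End.exists_eigenvalue (Linear.rightComp k A f)
  obtain ⟨w, hw⟩ := hc.exists_hasEigenvector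
  refine ⟨c, sub_eq_zero.1 (by_contra fun hne => H.comp_ne_zero hA hw.2 hne ?_)⟩
  have hwf : w ≫ f = c • w := hw.apply_eq_smul
  simp [hwf]

lemma isIso_of_ne_zero {A B : C} (hA : Indecomposable A) (hB : Indecomposable B) {s : A ⟶ B}
    {t : B ⟶ A} (hs : s ≠ 0) (ht : t ≠ 0) : IsIso s := by
  obtain ⟨c, hc⟩ := H.end_eq_smul_id hA (s ≫ t)
  have hc0 : c ≠ 0 := by
    rintro rfl
    exact H.comp_ne_zero hB hs ht (by rw [hc, zero_smul])
  have h1 : s ≫ (c⁻¹ • t) = 𝟙 A := by rw [Linear.comp_smul, hc, inv_smul_smul₀ hc0]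
  refine ⟨c⁻¹ • t, h1, sub_eq_zero.1 (by_contra fun hne => H.comp_ne_zero hB hs hne ?_)⟩
  rw [Preadditive.comp_sub, reassoc_of% h1, Category.comp_id, sub_self]

lemma isIso_of_isSplitMono {A B : C} (hA : Indecomposable A) (hB : Indecomposable B) (s : A ⟶ B)
    [IsSplitMono s] : IsIso s := by
  have h1 : 𝟙 A ≠ 0 := fun h => hA.1 ((IsZero.iff_id_eq_zero A).2 h)
  refine H.isIso_of_ne_zero hA hB (t := retraction s) ?_ ?_
  · exact fun h => h1 ((IsSplitMono.id s).symm.trans ((h =≫ _).trans zero_comp))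
  · exact fun h => h1 ((IsSplitMono.id s).symm.trans ((s ≫= h).trans comp_zero))

lemma isIso_of_isSplitEpi {A B : C} (hA : Indecomposable A) (hB : Indecomposable B) (s : A ⟶ B)
    [IsSplitEpi s] : IsIso s := by
  have h1 : 𝟙 B ≠ 0 := fun h => hB.1 ((IsZero.iff_id_eq_zero B).2 h)
  refine H.isIso_of_ne_zero hA hB (t := section_ s) ?_ ?_
  · exact fun h => h1 ((IsSplitEpi.id s).symm.trans ((_ ≫= h).trans comp_zero))
  · exact fun h => h1 ((IsSplitEpi.id s).symm.trans ((h =≫ s).trans zero_comp))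

/-- If the direct successor `M` of `A` is a thread object, then its direct predecessor is `A`. -/
lemma isAlmostSplitTo_of_isAlmostSplitFrom {A M : C} (hA : Indecomposable A)
    (hM : IsThreadObject M) {s : A ⟶ M} (hs0 : s ≠ 0) (hs : IsAlmostSplitFrom s) :
    IsAlmostSplitTo s := by
  obtain ⟨hMi, -, N, p, hN, hp0, hp, hpf⟩ := hM
  have hse : ¬ IsSplitEpi s := fun h => by
    have := H.isIso_of_isSplitEpi hA hMi s
    exact hs.1 inferInstance
  refine ⟨hse, fun B g hg => ?_⟩
  obtain ⟨s', hs'⟩ := hpf s hse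
  by_cases hsm : IsSplitMono s'
  · have := H.isIso_of_isSplitMono hA hN s'
    obtain ⟨x, hx⟩ := hpf g hg
    exact ⟨x ≫ inv s', by rw [← hs', Category.assoc, IsIso.inv_hom_id_assoc, hx]⟩
  · obtain ⟨t, ht⟩ := hs.2 s' hsm
    refine absurd ⟨⟨t, ?_⟩⟩ hp
    refine sub_eq_zero.1 (by_contra fun hne => H.comp_ne_zero hMi hs0 hne ?_)
    rw [Preadditive.comp_sub, reassoc_of% ht, hs', Category.comp_id, sub_self]

/-- Maps between the ends of a thread are unique up to scalars. -/
lemma exists_smul_eq {X Y : C} (hX : Indecomposable X) (hY : Indecomposable Y)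
    (hT : ∀ Z : C, Indecomposable Z → (∃ f : X ⟶ Z, f ≠ 0) → (∃ g : Z ⟶ Y, g ≠ 0) →
      IsThreadObject Z) {f : X ⟶ Y} (hf : f ≠ 0) (g : X ⟶ Y) : ∃ c : k, c • f = g := by
  by_contra hg
  obtain ⟨l, hlg, hl⟩ := Submodule.exists_le_ker_of_notMem
    (p := Submodule.span k {f}) (v := g) (by rwa [Submodule.mem_span_singleton])
  have hlf : l f = 0 := hl (Submodule.mem_span_singleton_self f)
  obtain ⟨U, u, hu, hul, hU⟩ := H.exists_functional_kernel l
  obtain ⟨x, hx⟩ := hU f fun e => by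
    obtain ⟨c, rfl⟩ := H.end_eq_smul_id hX e
    rw [Linear.smul_comp, Category.id_comp, map_smul, hlf, smul_zero]
  obtain ⟨V, i, r, hV, hir, hxr⟩ := exists_indecomposable_summand H.finiteDimensional x (by
    rintro rfl; exact hf (by rw [← hx, zero_comp]))
  have hi : Mono i := mono_of_mono_fac hir
  have hiu : i ≫ u ≠ 0 := fun h => hV.1 <| (IsZero.iff_id_eq_zero V).2 <| by
    rw [← cancel_mono (i ≫ u), h, comp_zero, comp_zero]
  have hiul : ∀ y : X ⟶ V, l (y ≫ i ≫ u) = 0 := fun y => by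
    rw [← Category.assoc]; exact hul _
  obtain ⟨-, ⟨M, s, hM, hs0, hs⟩, -⟩ := hT V hV ⟨_, hxr⟩ ⟨_, hiu⟩
  obtain ⟨m, hm⟩ := hs.2 (i ≫ u) fun hsplit => hlg <| by
    have := H.isIso_of_isSplitMono hV hY (i ≫ u)
    have := hiul (g ≫ inv (i ≫ u))
    rwa [Category.assoc, IsIso.inv_hom_id, Category.comp_id] at this
  have hm0 : m ≠ 0 := by rintro rfl; exact hiu (by rw [← hm, comp_zero])
  have hMT := hT M hM ⟨_, H.comp_ne_zero hV hxr hs0⟩ ⟨m, hm0⟩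
  have hsT := H.isAlmostSplitTo_of_isAlmostSplitFrom hV hMT hs0 hs
  obtain ⟨m', hm'⟩ := hU m fun y => by
    by_cases hy : IsSplitEpi y
    · have := H.isIso_of_isSplitEpi hX hM y
      have hxr' : inv y ≫ x ≫ r ≠ 0 := fun h => hxr (by rwa [IsIso.inv_comp_eq, comp_zero] at h)
      have := H.isIso_of_ne_zero hV hM hs0 hxr'
      exact (hs.1 inferInstance).elim
    · obtain ⟨y', rfl⟩ := hsT.2 y hy
      rw [Category.assoc, hm]
      exact hiul y'
  refine hs.1 ⟨⟨m' ≫ r, ?_⟩⟩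
  have : s ≫ m' = i := by rw [← cancel_mono u, Category.assoc, hm', hm]
  rw [reassoc_of% this, hir]

/-- Any two indecomposable objects of a thread are comparable. -/
lemma comparable {X Y Z W : C} (hX : Indecomposable X) (hY : Indecomposable Y)
    (hT : ∀ Z : C, Indecomposable Z → (∃ f : X ⟶ Z, f ≠ 0) → (∃ g : Z ⟶ Y, g ≠ 0) →
      IsThreadObject Z) (hZ : Indecomposable Z) (hW : Indecomposable W)
    {a : X ⟶ Z} {b : Z ⟶ Y} {c : X ⟶ W} {d : W ⟶ Y} (ha : a ≠ 0) (hb : b ≠ 0) (hc : c ≠ 0)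
    (hd : d ≠ 0) : (∃ f : Z ⟶ W, f ≠ 0) ∨ ∃ f : W ⟶ Z, f ≠ 0 := by
  by_contra! hne
  obtain ⟨μ, hμ⟩ := H.exists_smul_eq hX hY hT (H.comp_ne_zero hZ ha hb) (c ≫ d)
  have := H.mono_of_ne_zero d hW hd
  have := H.mono_of_ne_zero b hZ hb
  obtain ⟨K, u, hu, hu0, hK⟩ := H.exists_kernel (biprod.desc b (-d))
  obtain ⟨x, hx⟩ := hK (biprod.lift (μ • a) c) (by
    rw [biprod.lift_desc, Linear.smul_comp, hμ, Preadditive.comp_neg, add_neg_cancel])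
  have hx0 : x ≠ 0 := by
    rintro rfl
    apply hc
    rw [← biprod.lift_snd (μ • a) c, ← hx, zero_comp, zero_comp]
  obtain ⟨V, i, r, hV, hir, hxr⟩ := exists_indecomposable_summand H.finiteDimensional x hx0
  have hi : Mono i := mono_of_mono_fac hir
  have hpq : (i ≫ u ≫ biprod.fst) ≫ b = (i ≫ u ≫ biprod.snd) ≫ d := by
    have := congr(i ≫ $hu0)
    rw [biprod.desc_eq, Preadditive.comp_add, Preadditive.comp_neg, Preadditive.comp_neg,
      ← sub_eq_add_neg, Preadditive.comp_sub, comp_zero, sub_eq_zero] at this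
    simpa using this
  obtain ⟨p, hp⟩ : ∃ p, p = i ≫ u ≫ biprod.fst := ⟨_, rfl⟩
  obtain ⟨q, hq⟩ : ∃ q, q = i ≫ u ≫ biprod.snd := ⟨_, rfl⟩
  rw [← hp, ← hq] at hpq
  have hiu : i ≫ u = biprod.lift p q := by ext <;> simp [hp, hq]
  have hzero : p = 0 → q = 0 → False := by
    rintro rfl rfl
    refine hV.1 <| (IsZero.iff_id_eq_zero V).2 ?_
    rw [← cancel_mono (i ≫ u), hiu]
    ext <;> simp
  have hp0 : p ≠ 0 := fun h => hzero h <| by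
    rwa [h, zero_comp, eq_comm, ← zero_comp (f := d), cancel_mono] at hpq
  have hq0 : q ≠ 0 := fun h => hzero (by
    rwa [h, zero_comp, ← zero_comp (f := b), cancel_mono] at hpq) h
  obtain ⟨-, ⟨M, s, hM, hs0, hs⟩, -⟩ := hT V hV ⟨_, hxr⟩ ⟨_, H.comp_ne_zero hZ hp0 hb⟩
  obtain ⟨p', hp'⟩ := hs.2 p fun hsplit => by
    have := H.isIso_of_isSplitMono hV hZ p
    exact hq0 (by rw [← IsIso.hom_inv_id_assoc p q, hne.1 (inv p ≫ q), comp_zero])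
  obtain ⟨q', hq'⟩ := hs.2 q fun hsplit => by
    have := H.isIso_of_isSplitMono hV hW q
    exact hp0 (by rw [← IsIso.hom_inv_id_assoc q p, hne.2 (inv q ≫ p), comp_zero])
  have hpq' : p' ≫ b = q' ≫ d :=
    sub_eq_zero.1 (by_contra fun h => H.comp_ne_zero hM hs0 h (by
      rw [Preadditive.comp_sub, reassoc_of% hp', reassoc_of% hq', hpq, sub_self]))
  obtain ⟨m, hm⟩ := hK (biprod.lift p' q') (by
    rw [biprod.lift_desc, hpq', Preadditive.comp_neg, add_neg_cancel])
  refine hs.1 ⟨⟨m ≫ r, ?_⟩⟩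
  have : s ≫ m = i := by
    rw [← cancel_mono u, Category.assoc, hm, hiu]
    ext <;> simp [hp', hq']
  rw [reassoc_of% this, hir]

end ThreadAmbient

end Segments

section LinearExtension

variable (k : Type*) [Field k] {C : Type*} [Category* C] [Preadditive C] [Linear k C]
  {L : Type*} [Category* L]

/-- A scalar multiple of a morphism of `L`, as a morphism of the `k`-linearization. -/
def freeSingle {X Y : L} (h : X ⟶ Y) (r : k) : Free.of k X ⟶ Free.of k Y :=
  Finsupp.single h r

variable {k}

lemma free_induction {X Y : L} {p : (Free.of k X ⟶ Free.of k Y) → Prop}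
    (f : Free.of k X ⟶ Free.of k Y) (zero : p 0) (add : ∀ f g, p f → p g → p (f + g))
    (single : ∀ (h : X ⟶ Y) (r : k), p (freeSingle k h r)) : p f :=
  Finsupp.induction_linear f zero add single

lemma freeSingle_comp {X Y Z : L} (f : X ⟶ Y) (g : Y ⟶ Z) (r s : k) :
    freeSingle k f r ≫ freeSingle k g s = freeSingle k (f ≫ g) (r * s) :=
  Free.single_comp_single k L f g r s

/-- The action on morphisms of the extension of a functor to the `k`-linearization. -/
def linearExtensionMap (F : L ⥤ C) (X Y : L) :
    (Free.of k X ⟶ Free.of k Y) →ₗ[k] (F.obj X ⟶ F.obj Y) :=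
  Finsupp.linearCombination k fun h : X ⟶ Y => F.map h

lemma linearExtensionMap_single (F : L ⥤ C) {X Y : L} (h : X ⟶ Y) (r : k) :
    linearExtensionMap F X Y (freeSingle k h r) = r • F.map h :=
  Finsupp.linearCombination_single k r h

lemma linearExtensionMap_comp (F : L ⥤ C) {X Y Z : L} (f : Free.of k X ⟶ Free.of k Y)
    (g : Free.of k Y ⟶ Free.of k Z) : linearExtensionMap F X Z (f ≫ g) =
      linearExtensionMap F X Y f ≫ linearExtensionMap F Y Z g := by
  induction f using free_induction with
  | zero => simp
  | add f₁ f₂ w₁ w₂ => simp [w₁, w₂]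
  | single f' r =>
    induction g using free_induction with
    | zero => simp
    | add g₁ g₂ w₁ w₂ => simp [w₁, w₂]
    | single g' s =>
      simp [freeSingle_comp, linearExtensionMap_single, smul_smul, mul_comm]

/-- The extension of a functor to the `k`-linearization of its source. -/
def linearExtension (k : Type*) [Field k] [Linear k C] (F : L ⥤ C) : Free k L ⥤ C where
  obj X := F.obj X
  map {X Y} f := linearExtensionMap (k := k) F X Y f
  map_id X := (linearExtensionMap_single F (𝟙 (show L from X)) (1 : k)).trans
    ((one_smul _ _).trans (F.map_id _))
  map_comp f g := linearExtensionMap_comp F f g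

instance (F : L ⥤ C) : (linearExtension k F).Additive where
  map_add {X Y f g} := map_add (linearExtensionMap F X Y) f g

instance (F : L ⥤ C) : (linearExtension k F).Linear k where
  map_smul {X Y} f r := map_smul (linearExtensionMap F X Y) r f

end LinearExtension

section PosetExtension

variable {k : Type*} [Field k] {C : Type*} [Category* C] [Preadditive C] [Linear k C]
  {L : Type*} [Preorder L]

lemma exists_eq_freeSingle {a b : L} (f : Free.of k a ⟶ Free.of k b) (hf : f ≠ 0) :
    ∃ (h : a ⟶ b) (r : k), f = freeSingle k h r := by
  have key : f = 0 ∨ ∃ (h : a ⟶ b) (r : k), f = freeSingle k h r := by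
    clear hf
    induction f using free_induction with
    | zero => exact Or.inl rfl
    | add f g hf hg =>
      rcases hf with rfl | ⟨h, r, rfl⟩
      · rwa [zero_add]
      · rcases hg with rfl | ⟨h', s, rfl⟩
        · rw [add_zero]
          exact Or.inr ⟨h, r, rfl⟩
        · obtain rfl : h = h' := Subsingleton.elim _ _
          exact Or.inr ⟨h, r + s, (Finsupp.single_add h r s).symm⟩
    | single h r => exact Or.inr ⟨h, r, rfl⟩
  exact key.resolve_left hf

lemma linearExtension_faithful (F : L ⥤ C) (hF : ∀ {a b : L} (h : a ⟶ b), F.map h ≠ 0) :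
    (linearExtension k F).Faithful where
  map_injective {X Y} := by
    have key : ∀ a b : L, Function.Injective (linearExtensionMap (k := k) F a b) := by
      intro a b
      refine (injective_iff_map_eq_zero _).2 fun f hf => ?_
      by_contra hf0
      obtain ⟨h, r, rfl⟩ := exists_eq_freeSingle f hf0
      rw [linearExtensionMap_single] at hf
      obtain rfl := (smul_eq_zero.1 hf).resolve_right (hF h)
      exact hf0 (Finsupp.single_zero h)
    exact key X Y

lemma linearExtension_full (F : L ⥤ C)
    (hF : ∀ {a b : L} (f : F.obj a ⟶ F.obj b), f ≠ 0 → ∃ (h : a ⟶ b) (c : k), c • F.map h = f) :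
    (linearExtension k F).Full where
  map_surjective {X Y} := by
    have key : ∀ a b : L, Function.Surjective (linearExtensionMap (k := k) F a b) := by
      intro a b f
      by_cases hf : f = 0
      · exact ⟨0, by rw [hf, map_zero]⟩
      · obtain ⟨h, c, rfl⟩ := hF f hf
        exact ⟨freeSingle k h c, linearExtensionMap_single F h c⟩
    exact key X Y

end PosetExtension

section EssentialImage

variable {k : Type*} [Field k] {C : Type*} [Category* C] [Preadditive C] [Linear k C]
  {D : Type*} [Category* D] [Preadditive D] [Linear k D]

/-- A fully faithful linear functor restricts to an equivalence with its essential image. -/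
lemma exists_equivalence_fullSubcategory (G : D ⥤ C) [G.Additive] [G.Linear k] [G.Full]
    [G.Faithful] (P : ObjectProperty C) (hG : ∀ M, P (G.obj M))
    (hP : ∀ W, P W → ∃ M, Nonempty (W ≅ G.obj M)) :
    ∃ e : P.FullSubcategory ≌ D, e.functor.Additive ∧ e.functor.Linear k := by
  let G' := P.lift G hG
  have : G'.EssSurj := ⟨fun W => by
    obtain ⟨M, ⟨i⟩⟩ := hP _ W.property
    exact ⟨M, ⟨P.isoMk i.symm⟩⟩⟩
  have : G'.IsEquivalence := { }
  have h1 : G'.Additive := ⟨fun {M N f g} => by ext : 1; exact G.map_add⟩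
  have h2 : G'.Linear k := ⟨fun {M N} f r => by ext : 1; exact G.map_smul r f⟩
  have h1' : G'.asEquivalence.functor.Additive := h1
  have h2' : G'.asEquivalence.functor.Linear k := h2
  exact ⟨G'.asEquivalence.symm, inferInstanceAs G'.asEquivalence.inverse.Additive,
    inferInstanceAs (G'.asEquivalence.inverse.Linear k)⟩

end EssentialImage

section Matrices

variable {k : Type*} [Field k] {C : Type*} [Category* C] [Preadditive C] [Linear k C]
  [HasFiniteBiproducts C] {D : Type*} [Category* D] [Preadditive D] [Linear k D]

lemma matrix_add {I J : Type} [Finite I] [Finite J] {f : I → C} {g : J → C}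
    (m n : ∀ i j, f i ⟶ g j) :
    biproduct.matrix (fun i j => m i j + n i j) = biproduct.matrix m + biproduct.matrix n := by
  apply biproduct.hom_ext'
  intro i
  apply biproduct.hom_ext
  intro j
  simp

lemma matrix_smul {I J : Type} [Finite I] [Finite J] {f : I → C} {g : J → C} (r : k)
    (m : ∀ i j, f i ⟶ g j) :
    biproduct.matrix (fun i j => r • m i j) = r • biproduct.matrix m := by
  apply biproduct.hom_ext'
  intro i
  apply biproduct.hom_ext
  intro j
  simp

/-- The extension of an additive functor to the additive completion of its source. (In contrast to
`Mat_.lift`, there is no restriction on universes.) -/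
def matLift (F : D ⥤ C) [F.Additive] : Mat_ D ⥤ C where
  obj M := ⨁ fun i => F.obj (M.X i)
  map f := biproduct.matrix fun i j => F.map (f i j)
  map_id M := by
    ext i j
    by_cases h : j = i
    · subst h; simp
    · simp [h]
  map_comp f g := by
    ext i j
    simp [biproduct.lift_desc]

lemma matLift_map (F : D ⥤ C) [F.Additive] {M N : Mat_ D} (f : M ⟶ N) :
    (matLift F).map f = biproduct.matrix fun i j => F.map (f i j) := rfl

instance matLift_additive (F : D ⥤ C) [F.Additive] : (matLift F).Additive where
  map_add {M N f g} := by
    have hs : ∀ i j, (f + g) i j = f i j + g i j := fun i j => rfl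
    simp only [matLift_map, hs, F.map_add]
    exact matrix_add _ _

instance matLift_faithful (F : D ⥤ C) [F.Additive] [F.Faithful] : (matLift F).Faithful where
  map_injective {M N} f g h := by
    have h' := (biproduct.matrixEquiv (f := fun i => F.obj (M.X i))
      (g := fun j => F.obj (N.X j))).symm.injective h
    ext i j
    exact F.map_injective (congr_fun (congr_fun h' i) j)

instance matLift_full (F : D ⥤ C) [F.Additive] [F.Full] : (matLift F).Full where
  map_surjective {M N} f := by
    obtain ⟨m, rfl⟩ := (biproduct.matrixEquiv (f := fun i => F.obj (M.X i))
      (g := fun j => F.obj (N.X j))).symm.surjective f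
    exact ⟨fun i j => F.preimage (m i j),
      congrArg biproduct.matrix (funext fun i => funext fun j => F.map_preimage (m i j))⟩

instance matLift_linear (F : D ⥤ C) [F.Additive] [F.Linear k] : (matLift F).Linear k where
  map_smul {M N} f r := by
    have hs : ∀ i j, (r • f) i j = r • f i j := fun i j => rfl
    rw [matLift_map, matLift_map]
    simp only [hs, F.map_smul]
    exact matrix_smul r _

/-- A full subcategory whose objects are the finite direct sums of objects of a linear poset
embedded in a linear category is equivalent to the additive linearization of the poset. -/
theorem exists_equivalence_posetLinearization {L : Type*} [Preorder L] (F : L ⥤ C)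
    (hne : ∀ {a b : L} (h : a ⟶ b), F.map h ≠ 0)
    (hspan : ∀ {a b : L} (f : F.obj a ⟶ F.obj b), f ≠ 0 → ∃ (h : a ⟶ b) (c : k), c • F.map h = f)
    (P : ObjectProperty C)
    (hP : ∀ W, P W ↔ ∃ (n : ℕ) (a : Fin n → L), Nonempty (W ≅ ⨁ fun i => F.obj (a i))) :
    ∃ e : P.FullSubcategory ≌ Mat_ (Free k L), e.functor.Additive ∧ e.functor.Linear k := by
  have := linearExtension_faithful (k := k) F hne
  have := linearExtension_full (k := k) F hspan
  let G := matLift (linearExtension k F)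
  have hG : ∀ M, P (G.obj M) := fun M => (hP _).2 ⟨Fintype.card M.ι,
    fun i => M.X ((Fintype.equivFin M.ι).symm i),
    ⟨biproduct.whiskerEquiv (f := fun i => F.obj (show L from M.X i)) (Fintype.equivFin M.ι)
      fun j => eqToIso (congrArg (fun i => F.obj (show L from M.X i))
        (Equiv.symm_apply_apply _ j))⟩⟩
  exact exists_equivalence_fullSubcategory G P hG fun W hW => by
    obtain ⟨n, a, ⟨i⟩⟩ := (hP W).1 hW
    exact ⟨⟨Fin n, a⟩, ⟨i⟩⟩

end Matrices

section Threads

variable {k : Type v} [Field k] {C : Type u} [Category.{v} C] [Preadditive C] [Linear k C]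

lemma exists_component_ne_zero {n : ℕ} {Z : Fin n → C} [HasBiproduct Z] {W : C}
    (hW : ¬ IsZero W) (e : W ≅ ⨁ Z) : ∃ i, e.hom ≫ biproduct.π Z i ≠ 0 := by
  by_contra! h
  refine hW ((IsZero.iff_id_eq_zero W).2 ?_)
  rw [← cancel_mono e.hom]
  apply biproduct.hom_ext
  intro i
  simp [h i]

variable [HasFiniteBiproducts C]

attribute [local instance] hasBinaryBiproducts_of_finite_biproducts

/-- The indecomposable objects of `[X, Y]`. -/
def SegmentObject (X Y : C) : Type u :=
  {Z : C // Indecomposable Z ∧ (∃ f : X ⟶ Z, f ≠ 0) ∧ ∃ g : Z ⟶ Y, g ≠ 0}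

lemma interval_of_segmentObject {X Y : C} (Z : SegmentObject X Y) : interval X Y Z.1 :=
  ⟨1, fun _ => Z.1, fun _ => Z.2, ⟨(biproductUniqueIso fun _ : Fin 1 => Z.1).symm⟩⟩

namespace ThreadAmbient

variable (H : ThreadAmbient k C)

include H

lemma isThread_nonzero_hom {X Y : C} (h : IsThread X Y) : ∃ f : X ⟶ Y, f ≠ 0 := by
  obtain ⟨W, hW, n, Z, hZ, ⟨e⟩⟩ := h.nonzero
  obtain ⟨i, -⟩ := exists_component_ne_zero hW.1 e
  obtain ⟨hi, ⟨f, hf⟩, g, hg⟩ := hZ i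
  exact ⟨f ≫ g, H.comp_ne_zero hi hf hg⟩

/-- The preorder on indecomposables given by the existence of nonzero maps. -/
abbrev segmentPreorder (X Y : C) : Preorder (SegmentObject X Y) where
  le Z W := ∃ f : Z.1 ⟶ W.1, f ≠ 0
  le_refl Z := ⟨𝟙 Z.1, fun h => Z.2.1.1 ((IsZero.iff_id_eq_zero Z.1).2 h)⟩
  le_trans Z W V := fun ⟨f, hf⟩ ⟨g, hg⟩ => ⟨f ≫ g, H.comp_ne_zero W.2.1 hf hg⟩

/-- Normalized maps between the objects of a family of indecomposables below which a fixed object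
lies. -/
lemma exists_normalized_functor {L : Type*} [Preorder L] {X : C} (obj : L → C)
    (hobj : ∀ a, Indecomposable (obj a)) (x : ∀ a, X ⟶ obj a) (hx : ∀ a, x a ≠ 0)
    (hle : ∀ a b, a ≤ b ↔ ∃ f : obj a ⟶ obj b, f ≠ 0)
    (huniq : ∀ a (f : X ⟶ obj a), ∃ c : k, c • x a = f) :
    ∃ F : L ⥤ C, F.obj = obj ∧ (∀ {a b : L} (h : a ⟶ b), F.map h ≠ 0) ∧
      ∀ {a b : L} (f : F.obj a ⟶ F.obj b), f ≠ 0 → ∃ (h : a ⟶ b) (c : k), c • F.map h = f := by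
  have hcancel : ∀ {a b} (f g : obj a ⟶ obj b), x a ≫ f = x a ≫ g → f = g := fun {a b} f g h =>
    sub_eq_zero.1 (by_contra fun hne => H.comp_ne_zero (hobj a) (hx a) hne (by
      rw [Preadditive.comp_sub, h, sub_self]))
  have hex : ∀ a b, a ≤ b → ∃ φ : obj a ⟶ obj b, x a ≫ φ = x b := fun a b h => by
    obtain ⟨f, hf⟩ := (hle a b).1 h
    obtain ⟨c, hc⟩ := huniq b (x a ≫ f)
    have hc0 : c ≠ 0 := by
      rintro rfl
      exact H.comp_ne_zero (hobj a) (hx a) hf (by rw [← hc, zero_smul])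
    exact ⟨c⁻¹ • f, by rw [Linear.comp_smul, ← hc, inv_smul_smul₀ hc0]⟩
  choose φ hφ using hex
  let F : L ⥤ C :=
    { obj := obj
      map := fun {a b} h => φ a b (leOfHom h)
      map_id := fun a => hcancel _ _ (by rw [hφ, Category.comp_id])
      map_comp := fun {a b c} f g => hcancel _ _ (by
        rw [hφ, ← Category.assoc, hφ, hφ]) }
  refine ⟨F, rfl, fun {a b} h h0 => hx b ?_, fun {a b} f hf => ?_⟩
  · rw [← hφ a b (leOfHom h)]
    exact (_ ≫= h0).trans comp_zero
  · have hab := (hle a b).2 ⟨f, hf⟩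
    obtain ⟨c, hc⟩ := huniq b (x a ≫ f)
    refine ⟨homOfLE hab, c, hcancel (a := a) (b := b) _ _ ?_⟩
    rw [Linear.comp_smul, ← hc, ← hφ a b hab]

variable [IsAlgClosed k]

/-- Every thread is equivalent to the linearization of a bounded locally discrete linear order. -/
theorem exists_equivalence_of_isThread {X Y : C} (hXY : IsThread X Y) :
    ∃ (L : Type u) (_ : LinearOrder L) (_ : BoundedOrder L), IsLocallyDiscrete L ∧
      ∃ e : (interval X Y).FullSubcategory ≌ PosetLinearization k L,
        e.functor.Additive ∧ e.functor.Linear k := by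
  classical
  obtain ⟨f₀, hf₀⟩ := H.isThread_nonzero_hom hXY
  have hX := hXY.indecomposable_left
  have hY := hXY.indecomposable_right
  have hid : ∀ {Z : C}, Indecomposable Z → 𝟙 Z ≠ 0 := fun {Z} hZ h =>
    hZ.1 ((IsZero.iff_id_eq_zero Z).2 h)
  have hT : ∀ Z : C, Indecomposable Z → (∃ f : X ⟶ Z, f ≠ 0) → (∃ g : Z ⟶ Y, g ≠ 0) →
      IsThreadObject Z := fun Z hZ hf hg =>
    hXY.isThreadObject Z hZ (interval_of_segmentObject ⟨Z, hZ, hf, hg⟩)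
  let _ : Preorder (SegmentObject X Y) := H.segmentPreorder X Y
  have hle : ∀ Z W : SegmentObject X Y, Z ≤ W ↔ ∃ f : Z.1 ⟶ W.1, f ≠ 0 := fun _ _ => Iff.rfl
  have : @Std.Total (SegmentObject X Y) (· ≤ ·) := ⟨fun Z W => by
    obtain ⟨Z, hZ, ⟨a, ha⟩, b, hb⟩ := Z
    obtain ⟨W, hW, ⟨c, hc⟩, d, hd⟩ := W
    exact H.comparable hX hY hT hZ hW ha hb hc hd⟩
  let L := Antisymmetrization (SegmentObject X Y) (· ≤ ·)
  let mk : SegmentObject X Y → L := toAntisymmetrization (· ≤ ·)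
  let _ : LinearOrder L := inferInstance
  have hmk : ∀ Z W, mk Z ≤ mk W ↔ Z ≤ W := fun _ _ => Iff.rfl
  have hmksurj : ∀ a : L, ∃ Z, mk Z = a := Quotient.exists_rep
  let bX : SegmentObject X Y := ⟨X, hX, ⟨𝟙 X, hid hX⟩, f₀, hf₀⟩
  let bY : SegmentObject X Y := ⟨Y, hY, ⟨f₀, hf₀⟩, 𝟙 Y, hid hY⟩
  let _ : BoundedOrder L :=
    { bot := mk bX
      top := mk bY
      bot_le := fun a => by
        obtain ⟨Z, rfl⟩ := hmksurj a
        exact Z.2.2.1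
      le_top := fun a => by
        obtain ⟨Z, rfl⟩ := hmksurj a
        exact Z.2.2.2 }
  have hiso : ∀ Z W : SegmentObject X Y, Z ≤ W → ∀ g : Z.1 ⟶ W.1, IsIso g → W ≤ Z :=
    fun Z W _ g _ => ⟨inv g, fun h => hid W.2.1 (by rw [← IsIso.inv_hom_id g, h, zero_comp])⟩
  refine ⟨L, inferInstance, inferInstance, ⟨fun a ha => ?_, fun a ha => ?_⟩, ?_⟩
  · obtain ⟨Z, rfl⟩ := hmksurj a
    have hZY : ¬ mk bY ≤ mk Z := fun h => ha fun b _ => le_trans le_top h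
    obtain ⟨hZ, ⟨x, hx⟩, g, hg⟩ := Z.2
    obtain ⟨-, ⟨M, s, hM, hs0, hs⟩, -⟩ := hT Z.1 hZ ⟨x, hx⟩ ⟨g, hg⟩
    obtain ⟨m, hm⟩ := hs.2 g fun _ =>
      hZY (hiso Z bY ⟨g, hg⟩ g (H.isIso_of_isSplitMono hZ hY g))
    let M' : SegmentObject X Y := ⟨M, hM, ⟨x ≫ s, H.comp_ne_zero hZ hx hs0⟩, m, by
      rintro rfl; exact hg (by rw [← hm, comp_zero])⟩
    refine ⟨mk M', lt_of_le_not_ge ⟨s, hs0⟩ ?_, fun {c} hc hcM => ?_⟩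
    · rintro ⟨t, ht⟩
      have := H.isIso_of_ne_zero hZ hM hs0 ht
      exact hs.1 inferInstance
    · obtain ⟨W, rfl⟩ := hmksurj c
      obtain ⟨h, hh⟩ := hc.le
      obtain ⟨t, ht⟩ := hs.2 h fun _ =>
        hc.not_ge (hiso Z W ⟨h, hh⟩ h (H.isIso_of_isSplitMono hZ W.2.1 h))
      exact hcM.not_ge ⟨t, by rintro rfl; exact hh (by rw [← ht, comp_zero])⟩
  · obtain ⟨Z, rfl⟩ := hmksurj a
    have hZX : ¬ mk Z ≤ mk bX := fun h => ha fun b _ => le_trans h bot_le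
    obtain ⟨hZ, ⟨x, hx⟩, g, hg⟩ := Z.2
    obtain ⟨-, -, ⟨N, p, hN, hp0, hp⟩⟩ := hT Z.1 hZ ⟨x, hx⟩ ⟨g, hg⟩
    obtain ⟨n, hn⟩ := hp.2 x fun _ =>
      hZX (hiso bX Z ⟨x, hx⟩ x (H.isIso_of_isSplitEpi hX hZ x))
    let N' : SegmentObject X Y := ⟨N, hN, ⟨n, by
      rintro rfl; exact hx (by rw [← hn, zero_comp])⟩, p ≫ g, H.comp_ne_zero hZ hp0 hg⟩
    refine ⟨mk N', lt_of_le_not_ge ⟨p, hp0⟩ ?_, fun {c} hNc hc => ?_⟩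
    · rintro ⟨t, ht⟩
      have := H.isIso_of_ne_zero hN hZ hp0 ht
      exact hp.1 inferInstance
    · obtain ⟨W, rfl⟩ := hmksurj c
      obtain ⟨h, hh⟩ := hc.le
      obtain ⟨t, ht⟩ := hp.2 h fun _ =>
        hc.not_ge (hiso W Z ⟨h, hh⟩ h (H.isIso_of_isSplitEpi W.2.1 hZ h))
      exact hNc.not_ge ⟨t, by rintro rfl; exact hh (by rw [← ht, zero_comp])⟩
  · let rep : L → SegmentObject X Y := ofAntisymmetrization (· ≤ ·)
    have hrep : ∀ a, mk (rep a) = a := toAntisymmetrization_ofAntisymmetrization (· ≤ ·)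
    choose x hx using fun a : L => (rep a).2.2.1
    obtain ⟨F, hF, hne, hspan⟩ := H.exists_normalized_functor (fun a : L => (rep a).1)
      (fun a => (rep a).2.1) x hx (fun a b => by
        rw [← hle, ← hmk, hrep, hrep])
      (fun a f => by
        obtain ⟨hZ, -, g, hg⟩ := (rep a).2
        exact H.exists_smul_eq hX hZ (fun W hW hXW ⟨w, hw⟩ =>
          hT W hW hXW ⟨w ≫ g, H.comp_ne_zero hZ hw hg⟩) (hx a) f)
    refine exists_equivalence_posetLinearization F hne hspan _ fun W => ?_
    rw [hF]
    constructor
    · rintro ⟨n, Z, hZ, ⟨e⟩⟩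
      have hi : ∀ i, Nonempty ((rep (mk ⟨Z i, hZ i⟩)).1 ≅ Z i) := fun i => by
        obtain ⟨⟨s, hs⟩, t, ht⟩ : AntisymmRel (· ≤ ·) (rep (mk ⟨Z i, hZ i⟩))
            (⟨Z i, hZ i⟩ : SegmentObject X Y) :=
          ⟨(hmk _ _).1 (hrep _).le, (hmk _ _).1 (hrep _).ge⟩
        have := H.isIso_of_ne_zero (rep _).2.1 (hZ i).1 hs ht
        exact ⟨asIso s⟩
      exact ⟨n, fun i => mk ⟨Z i, hZ i⟩,
        ⟨e ≪≫ biproduct.mapIso fun i => (Classical.choice (hi i)).symm⟩⟩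
    · rintro ⟨n, a, he⟩
      exact ⟨n, fun i => (rep (a i)).1, fun i => (rep (a i)).2, he⟩

end ThreadAmbient

end Threads

end ThreadVariety

end

theorem mainTheorem8 {k : Type v} [Field k] [IsAlgClosed k]
    {C : Type u} [Category.{v} C] [Preadditive C] [Linear k C]
    [HasFiniteBiproducts C] [IsIdempotentComplete C]
    (hfin : ∀ A B : C, FiniteDimensional k (A ⟶ B))
    (hsh : ThreadVariety.IsSemiHereditary k C) (hdual : ThreadVariety.IsDualizing k C)
    (X Y : C) (hXY : ThreadVariety.IsThread X Y) :
    ∃ (L : Type u) (_ : LinearOrder L) (_ : BoundedOrder L),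
      ThreadVariety.IsLocallyDiscrete L ∧
        ∃ e : (ThreadVariety.interval X Y).FullSubcategory ≌
            ThreadVariety.PosetLinearization k L,
          e.functor.Additive ∧ e.functor.Linear k :=
  (ThreadVariety.ThreadAmbient.of_isSemiHereditary_of_isDualizing hfin hsh
    hdual).exists_equivalence_of_isThread hXY
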